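/- Let $(M,\omega)$ be a $2n$-dimensional symplectic manifold (Hausdorff, second countable, with $\omega$ a smooth closed nondegenerate 2-form), and let $C^\infty(M)$ be the complex vector space of smooth complex-valued functions on $M$. For $f\in C^\infty(M)$ let $X_f$ be its Hamiltonian field (a section of the complexified tangent bundle), defined by $df(X)=\omega(X_f,X)$ for all vector fields $X$, and put $\{f,g\}=\omega(X_f,X_g)=df(X_g)$, with $\omega$ extended complex-bilinearly. Foliations are understood as follows. A *foliated chart* of codimension $k$ is a smooth submersion $\varphi:U\to\mathbb{R}^k$ from an open set $U\subseteq M$ onto an open subset of $\mathbb{R}^k$. Foliated charts $\varphi:U\to\mathbb{R}^k$ and $\psi:V\to\mathbb{R}^k$ are *compatible* if there is a smooth diffeomorphism $\xi:\varphi(U\cap V)\to\psi(U\cap V)$ with $\xi\circ\varphi=\psi$ on $U\cap V$. A *foliation* $\mathcal{F}$ of codimension $k$ is given by a family of pairwise compatible foliated charts of codimension $k$ whose domains cover $M$. Its *plaques* are the connected components of the fibers of its foliated charts, and its *leaves* are the classes of the equivalence relation in which $x\sim y$ if and only if there are plaques $P_0,\dots,P_l$ with $x\in P_0$, $y\in P_l$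 and $P_{j-1}\cap P_j\neq\emptyset$ for $j=1,\dots,l$. The foliation is *Lagrangian* if every leaf is a Lagrangian (immersed) submanifold of $M$, i.e. the image of an injective smooth immersion $\iota:N\to M$ of an $n$-dimensional (Hausdorff, second countable) manifold $N$ with $\iota^*\omega=0$. **Theorem.** Let $\mathcal{A}$ be a complex vector subspace of $C^\infty(M)$ which is closed under complex conjugation. Suppose that 1. $\{a,b\}=0$ for every $a,b\in\mathcal{A}$, and 2. for every $p\in M$ there exist real-valued elements $a_1,\dots,a_n\in\mathcal{A}$ such that $d(a_1)_p,\dots,d(a_n)_p$ are linearly independent over $\mathbb{R}$. Then there is a Lagrangian foliation $\mathcal{F}$ of $M$, of codimension $n$, such that every element of $\mathcal{A}$ is constant along every leaf of $\mathcal{F}$; that is, $\mathcal{A}\subseteq\mathcal{A}_{\mathcal{F}}(M)$, where $\mathcal{A}_{\mathcal{F}}(M)$ is the space of functions in $C^\infty(M)$ that are constant along every leaf of $\mathcal{F}$. -/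

import Mathlib

open Set
open scoped Manifold ContDiff

noncomputable section

namespace LagFol

universe u

instance tangentSpace_finiteDimensional {d : ℕ} {M : Type u} [TopologicalSpace M]
    [ChartedSpace (EuclideanSpace ℝ (Fin d)) M] (p : M) :
    FiniteDimensional ℝ (TangentSpace (𝓡 d) p) :=
  inferInstanceAs (FiniteDimensional ℝ (EuclideanSpace ℝ (Fin d)))

/-- The coordinate expression, in a chart `e` of `M`, of a (not necessarily smooth) `2`-form `Ω`
on `M`: the pullback of `Ω` by the inverse of the chart. It is meaningful on `e.target`. -/
def formInChart {d : ℕ} {M : Type u} [TopologicalSpace M]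
    [ChartedSpace (EuclideanSpace ℝ (Fin d)) M]
    (Ω : ∀ p : M, TangentSpace (𝓡 d) p [⋀^Fin 2]→L[ℝ] ℝ)
    (e : OpenPartialHomeomorph M (EuclideanSpace ℝ (Fin d))) (y : EuclideanSpace ℝ (Fin d)) :
    EuclideanSpace ℝ (Fin d) [⋀^Fin 2]→L[ℝ] ℝ :=
  (Ω (e.symm y)).compContinuousLinearMap (mfderiv (𝓡 d) (𝓡 d) e.symm y)

/-- A symplectic form on a smooth `d`-dimensional manifold `M`: a smooth closed nondegenerate
`2`-form. Smoothness and `dΩ = 0` are expressed in the charts of the atlas of `M`. -/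
structure SymplecticForm (d : ℕ) (M : Type u) [TopologicalSpace M]
    [ChartedSpace (EuclideanSpace ℝ (Fin d)) M] where
  form : ∀ p : M, TangentSpace (𝓡 d) p [⋀^Fin 2]→L[ℝ] ℝ
  smooth : ∀ e ∈ atlas (EuclideanSpace ℝ (Fin d)) M, ContDiffOn ℝ ∞ (formInChart form e) e.target
  closed : ∀ e ∈ atlas (EuclideanSpace ℝ (Fin d)) M, ∀ y ∈ e.target,
    extDeriv (formInChart form e) y = 0
  nondegenerate : ∀ (p : M) (v : TangentSpace (𝓡 d) p), (∀ w, form p ![v, w] = 0) → v = 0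

/-- The complex vector space `C^∞(M)` of smooth complex-valued functions on `M`. -/
def smoothFunctions (d : ℕ) (M : Type u) [TopologicalSpace M]
    [ChartedSpace (EuclideanSpace ℝ (Fin d)) M] : Submodule ℂ (M → ℂ) where
  carrier := {f | ContMDiff (𝓡 d) 𝓘(ℝ, ℂ) ∞ f}
  add_mem' hf hg := ContMDiff.add hf hg
  zero_mem' := contMDiff_const
  smul_mem' c f hf :=
    ((ContinuousLinearMap.mul ℝ ℂ c).contDiff.contMDiff (n := ∞)).comp
      (show ContMDiff (𝓡 d) 𝓘(ℝ, ℂ) ∞ f from hf)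

section Hamiltonian

variable {d : ℕ} {M : Type u} [TopologicalSpace M] [ChartedSpace (EuclideanSpace ℝ (Fin d)) M]

/-- The linear map `v ↦ Ω(v, ·)` from `T_p M` to its dual. -/
def SymplecticForm.flat (Ω : SymplecticForm d M) (p : M) :
    TangentSpace (𝓡 d) p →ₗ[ℝ] Module.Dual ℝ (TangentSpace (𝓡 d) p) :=
  LinearMap.mk₂ ℝ (fun v w => Ω.form p ![v, w])
    (fun v v' w => (Ω.form p).toMultilinearMap.cons_add ![w] v v')
    (fun c v w => (Ω.form p).toMultilinearMap.cons_smul ![w] c v)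
    (fun v w w' => by
      have h := (Ω.form p).map_update_add ![v, 0] 1 w w'
      have h2 (x : TangentSpace (𝓡 d) p) : Function.update ![v, 0] 1 x = ![v, x] := by
        ext i; fin_cases i <;> rfl
      rwa [h2, h2, h2] at h)
    (fun c v w => by
      have h := (Ω.form p).map_update_smul ![v, 0] 1 c w
      have h2 (x : TangentSpace (𝓡 d) p) : Function.update ![v, 0] 1 x = ![v, x] := by
        ext i; fin_cases i <;> rfl
      rwa [h2, h2] at h)

/-- Nondegeneracy of `Ω` makes `v ↦ Ω(v, ·)` an isomorphism of `T_p M` onto its dual. -/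
def SymplecticForm.flatEquiv (Ω : SymplecticForm d M) (p : M) :
    TangentSpace (𝓡 d) p ≃ₗ[ℝ] Module.Dual ℝ (TangentSpace (𝓡 d) p) :=
  LinearEquiv.ofInjectiveOfFinrankEq (Ω.flat p)
    (by
      rw [← LinearMap.ker_eq_bot, LinearMap.ker_eq_bot']
      intro v hv
      exact Ω.nondegenerate p v fun w => LinearMap.congr_fun hv w)
    Subspace.dual_finrank_eq.symm

/-- The Hamiltonian vector field `X_f` of a real-valued function `f`, given by
`df(X) = Ω(X_f, X)`. -/
def SymplecticForm.hamiltonianField (Ω : SymplecticForm d M) (f : M → ℝ) (p : M) :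
    TangentSpace (𝓡 d) p :=
  (Ω.flatEquiv p).symm (mvfderiv (𝓡 d) f p).toLinearMap

theorem SymplecticForm.form_hamiltonianField (Ω : SymplecticForm d M) (f : M → ℝ) (p : M)
    (v : TangentSpace (𝓡 d) p) :
    Ω.form p ![Ω.hamiltonianField f p, v] = mvfderiv (𝓡 d) f p v :=
  LinearMap.congr_fun ((Ω.flatEquiv p).apply_symm_apply (mvfderiv (𝓡 d) f p).toLinearMap) v

/-- The Poisson bracket `{f, g} = Ω(X_f, X_g)` of complex-valued functions. Here the Hamiltonian
field of `f` is the section `X_f = X_{Re f} + i X_{Im f}` of the complexified tangent bundle, and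
`Ω` is extended complex-bilinearly. -/
def SymplecticForm.poissonBracket (Ω : SymplecticForm d M) (f g : M → ℂ) (p : M) : ℂ :=
  let X := Ω.hamiltonianField (fun q => (f q).re) p
  let X' := Ω.hamiltonianField (fun q => (f q).im) p
  let Y := Ω.hamiltonianField (fun q => (g q).re) p
  let Y' := Ω.hamiltonianField (fun q => (g q).im) p
  ((Ω.form p ![X, Y] : ℝ) - (Ω.form p ![X', Y'] : ℝ)) +
    Complex.I * ((Ω.form p ![X, Y'] : ℝ) + (Ω.form p ![X', Y] : ℝ))

/-- The bracket is also `{f, g} = df(X_g)`. -/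
theorem SymplecticForm.poissonBracket_eq (Ω : SymplecticForm d M) {f g : M → ℂ} {p : M}
    (hf : MDifferentiableAt (𝓡 d) 𝓘(ℝ, ℂ) f p) :
    Ω.poissonBracket f g p =
      mvfderiv (𝓡 d) f p (Ω.hamiltonianField (fun q => (g q).re) p) +
        Complex.I * mvfderiv (𝓡 d) f p (Ω.hamiltonianField (fun q => (g q).im) p) := by
  have hre (v : TangentSpace (𝓡 d) p) :
      mvfderiv (𝓡 d) (fun q => (f q).re) p v = (mvfderiv (𝓡 d) f p v).re := by
    have h := (Complex.reCLM.hasMFDerivAt (x := f p)).comp p hf.hasMFDerivAt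
    exact DFunLike.congr_fun h.mfderiv v
  have him (v : TangentSpace (𝓡 d) p) :
      mvfderiv (𝓡 d) (fun q => (f q).im) p v = (mvfderiv (𝓡 d) f p v).im := by
    have h := (Complex.imCLM.hasMFDerivAt (x := f p)).comp p hf.hasMFDerivAt
    exact DFunLike.congr_fun h.mfderiv v
  simp only [poissonBracket, form_hamiltonianField, hre, him]
  apply Complex.ext <;> simp <;> ring

end Hamiltonian

/-- A foliated chart of codimension `k`: a smooth submersion from an open subset of `M` onto an
open subset of `ℝ^k`. (The values of `toFun` outside of `domain` are irrelevant.) -/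
structure FoliatedChart (d : ℕ) (M : Type u) [TopologicalSpace M]
    [ChartedSpace (EuclideanSpace ℝ (Fin d)) M] (k : ℕ) where
  domain : Set M
  toFun : M → EuclideanSpace ℝ (Fin k)
  isOpen_domain : IsOpen domain
  isOpen_image : IsOpen (toFun '' domain)
  contMDiffOn : ContMDiffOn (𝓡 d) (𝓡 k) ∞ toFun domain
  submersion : ∀ p ∈ domain, Function.Surjective (mfderiv (𝓡 d) (𝓡 k) toFun p)

section Foliation

variable {d : ℕ} {M : Type u} [TopologicalSpace M] [ChartedSpace (EuclideanSpace ℝ (Fin d)) M]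
  {k : ℕ}

/-- Foliated charts `φ` on `U` and `ψ` on `V` are compatible if there is a smooth diffeomorphism
`ξ : φ(U ∩ V) → ψ(U ∩ V)` with `ξ ∘ φ = ψ` on `U ∩ V`. -/
def FoliatedChart.Compatible (φ ψ : FoliatedChart d M k) : Prop :=
  ∃ ξ : PartialDiffeomorph (𝓡 k) (𝓡 k) (EuclideanSpace ℝ (Fin k)) (EuclideanSpace ℝ (Fin k)) ∞,
    ξ.source = φ.toFun '' (φ.domain ∩ ψ.domain) ∧
    ξ.target = ψ.toFun '' (φ.domain ∩ ψ.domain) ∧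
    ∀ p ∈ φ.domain ∩ ψ.domain, ξ (φ.toFun p) = ψ.toFun p

variable (d M k) in
/-- A foliation of codimension `k`, given by a foliated atlas: a family of pairwise compatible
foliated charts whose domains cover `M`. -/
structure Foliation where
  charts : Set (FoliatedChart d M k)
  compatible : ∀ φ ∈ charts, ∀ ψ ∈ charts, φ.Compatible ψ
  cover : ∀ p : M, ∃ φ ∈ charts, p ∈ φ.domain

/-- The plaques: the connected components of the fibers of the foliated charts. -/
def Foliation.IsPlaque (F : Foliation d M k) (P : Set M) : Prop :=
  ∃ φ ∈ F.charts, ∃ p ∈ φ.domain,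
    P = connectedComponentIn (φ.domain ∩ φ.toFun ⁻¹' {φ.toFun p}) p

/-- Two points are equivalent if they are joined by a finite chain of plaques. -/
def Foliation.Rel (F : Foliation d M k) (x y : M) : Prop :=
  ∃ (l : ℕ) (P : ℕ → Set M), (∀ j ≤ l, F.IsPlaque (P j)) ∧ x ∈ P 0 ∧ y ∈ P l ∧
    ∀ j < l, (P j ∩ P (j + 1)).Nonempty

/-- The leaves: the classes of the relation `Foliation.Rel`. -/
def Foliation.IsLeaf (F : Foliation d M k) (L : Set M) : Prop :=
  ∃ x : M, L = {y | F.Rel x y}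

/-- The space `𝒜_F(M)` of the smooth complex-valued functions that are constant along every leaf
of `F`. -/
def Foliation.leafwiseConstant (F : Foliation d M k) : Submodule ℂ (M → ℂ) where
  carrier := {f | f ∈ smoothFunctions d M ∧ ∀ L, F.IsLeaf L → ∀ x ∈ L, ∀ y ∈ L, f x = f y}
  add_mem' hf hg := ⟨add_mem hf.1 hg.1, fun L hL x hx y hy => by
    simp only [Pi.add_apply, hf.2 L hL x hx y hy, hg.2 L hL x hx y hy]⟩
  zero_mem' := ⟨zero_mem _, fun _ _ _ _ _ _ => rfl⟩
  smul_mem' c _ hf := ⟨Submodule.smul_mem _ c hf.1, fun L hL x hx y hy => by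
    simp only [Pi.smul_apply, hf.2 L hL x hx y hy]⟩

end Foliation

section Lagrangian

variable {n : ℕ} {M : Type u} [TopologicalSpace M]
  [ChartedSpace (EuclideanSpace ℝ (Fin (2 * n))) M]

/-- `L ⊆ M` is a Lagrangian (immersed) submanifold of the `2n`-dimensional symplectic manifold
`(M, Ω)`: it is the image of an injective smooth immersion of an `n`-dimensional manifold
(Hausdorff and second countable) whose tangent spaces are isotropic for `Ω`. -/
def IsLagrangianSubmanifold (Ω : SymplecticForm (2 * n) M) (L : Set M) : Prop :=
  ∃ (N : Type u) (_ : TopologicalSpace N) (_ : ChartedSpace (EuclideanSpace ℝ (Fin n)) N)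
    (ι : N → M),
    IsManifold (𝓡 n) ∞ N ∧ T2Space N ∧ SecondCountableTopology N ∧
    ContMDiff (𝓡 n) (𝓡 (2 * n)) ∞ ι ∧ Function.Injective ι ∧
    (∀ x, Function.Injective (mfderiv (𝓡 n) (𝓡 (2 * n)) ι x)) ∧
    range ι = L ∧
    ∀ (x : N) (v w : TangentSpace (𝓡 n) x),
      Ω.form (ι x) ![mfderiv (𝓡 n) (𝓡 (2 * n)) ι x v, mfderiv (𝓡 n) (𝓡 (2 * n)) ι x w] = 0

/-- A foliation of a symplectic manifold is Lagrangian if its leaves are Lagrangian submanifolds.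
-/
def Foliation.IsLagrangian {k : ℕ} (F : Foliation (2 * n) M k) (Ω : SymplecticForm (2 * n) M) :
    Prop :=
  ∀ L, F.IsLeaf L → IsLagrangianSubmanifold Ω L

end Lagrangian

end LagFol

end

/-! Near each point choose `n` real elements of `A` with independent differentials and collect them
into a submersion `b` to `ℝ^n`. Since the brackets vanish, the `n` Hamiltonian fields of the
components of `b` lie in the kernel of `db`; they are independent, and this kernel has dimension `2n
- n = n`, so they span it (`SymplecticForm.ker_le_span_hamiltonianField`). Two consequences follow.
The kernel is isotropic, because `Ω(X_f, w) = df(w)`. And every `a ∈ A` has `da = 0` on the kernel,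
because `da(X_f) = {a, f}`; hence `a` is constant on the fibers of `b` in any box where these are
connected (`AdaptedBox.eq_of_apply_eq`).

Applied to the components of another such map `c`, this makes `b` and `c` locally functions of each
other, which is the compatibility of foliated charts (`AdaptedBox.compatible_foliatedChart`).
Elements of `A` are constant on plaques, hence on leaves.

The components of `b` themselves belong to `A`, so they are constant on leaves too, and a leaf meets
a box in at most one fiber (`commutingFoliation_rel_iff`). Leaves are therefore embedded: the
subspace topology serves as the manifold topology, and Hausdorffness and second countability are
inherited from `M` (`isLagrangianSubmanifold_of_adaptedBox`). -/

namespace LagFol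

universe u

open Metric

/-! ### Independent covectors and surjective maps -/

section LinearAlgebra

/-- The components of a linear map into `ℝ^k` are linearly independent if and only if the map is
surjective. -/
theorem linearIndependent_components_iff {V : Type*} [AddCommGroup V] [Module ℝ V] {k : ℕ}
    (f : Fin k → Module.Dual ℝ V) (g : V →ₗ[ℝ] EuclideanSpace ℝ (Fin k))
    (hg : ∀ v i, g v i = f i v) : LinearIndependent ℝ f ↔ Function.Surjective g := by
  rw [Fintype.linearIndependent_iff]
  constructor
  · intro h
    -- Surjectivity of `g` is injectivity of its transpose, and `φ ∘ g = 0` is a linear relation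
    -- among the `f i` with coefficients `φ (e_i)`.
    rw [← LinearMap.dualMap_injective_iff, injective_iff_map_eq_zero]
    intro φ hφ
    have key : ∀ x : EuclideanSpace ℝ (Fin k),
        φ x = ∑ i, φ (EuclideanSpace.single i 1) * x i := by
      intro x
      conv_lhs => rw [← (EuclideanSpace.basisFun (Fin k) ℝ).sum_repr x]
      simp [mul_comm]
    have h0 := h (fun i => φ (EuclideanSpace.single i 1)) (by
      ext v
      have := LinearMap.congr_fun hφ v
      rw [LinearMap.dualMap_apply, key] at this
      simpa [hg] using this)
    ext x
    rw [key]
    simp [h0]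
  · intro h c hc i
    obtain ⟨w, hw⟩ := h (EuclideanSpace.single i 1)
    have := LinearMap.congr_fun hc w
    simpa [← hg, hw, Pi.single_apply] using this

end LinearAlgebra

/-! ### Straightening a submersion -/

section Calculus

/-- A surjective linear map is the first component of an isomorphism onto a product. -/
theorem exists_continuousLinearEquiv_fst_eq {E F G : Type*}
    [NormedAddCommGroup E] [NormedSpace ℝ E] [NormedAddCommGroup F] [NormedSpace ℝ F]
    [NormedAddCommGroup G] [NormedSpace ℝ G] [FiniteDimensional ℝ E] [FiniteDimensional ℝ F]
    [FiniteDimensional ℝ G]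
    (hdim : Module.finrank ℝ E = Module.finrank ℝ F + Module.finrank ℝ G) (f : E →L[ℝ] F)
    (hf : Function.Surjective f) :
    ∃ (g : E →L[ℝ] G) (e : E ≃L[ℝ] F × G), (e : E →L[ℝ] F × G) = f.prod g := by
  have hker : Module.finrank ℝ f.toLinearMap.ker = Module.finrank ℝ G := by
    have h1 := f.toLinearMap.finrank_range_add_finrank_ker
    rw [LinearMap.range_eq_top.2 hf, finrank_top] at h1
    omega
  -- `q` is a projection onto the kernel of `f`. It supplies the complementary coordinate: a vector
  -- killed by `f` lies in the kernel, where `q` is the identity.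
  obtain ⟨q, hq⟩ := LinearMap.exists_leftInverse_of_injective f.toLinearMap.ker.subtype
    (Submodule.ker_subtype _)
  let e₁ := LinearEquiv.ofFinrankEq f.toLinearMap.ker G hker
  let g : E →L[ℝ] G := LinearMap.toContinuousLinearMap (e₁.toLinearMap ∘ₗ q)
  have hinj : Function.Injective (f.prod g).toLinearMap := by
    rw [injective_iff_map_eq_zero]
    intro v hv
    have h1 : f v = 0 := congrArg Prod.fst hv
    have h2 : e₁ (q v) = 0 := congrArg Prod.snd hv
    have h3 := LinearMap.congr_fun hq ⟨v, h1⟩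
    have h4 : q v = ⟨v, h1⟩ := h3
    rw [h4, LinearEquiv.map_eq_zero_iff] at h2
    exact congrArg Subtype.val h2
  refine ⟨g, (LinearEquiv.ofInjectiveOfFinrankEq (f.prod g).toLinearMap hinj
    (by rw [hdim, Module.finrank_prod])).toContinuousLinearEquiv, ?_⟩
  ext v <;> rfl

/-- A smooth map that is a submersion at a point is, near that point, the first component of a
smooth coordinate system. -/
theorem exists_openPartialHomeomorph_fst_eq {E F G : Type*}
    [NormedAddCommGroup E] [NormedSpace ℝ E] [NormedAddCommGroup F] [NormedSpace ℝ F]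
    [NormedAddCommGroup G] [NormedSpace ℝ G] [FiniteDimensional ℝ E] [FiniteDimensional ℝ F]
    [FiniteDimensional ℝ G]
    (hdim : Module.finrank ℝ E = Module.finrank ℝ F + Module.finrank ℝ G)
    {f : E → F} {s : Set E} {x : E} (hs : IsOpen s) (hx : x ∈ s) (hf : ContDiffOn ℝ ∞ f s)
    (hsurj : Function.Surjective (fderiv ℝ f x)) :
    ∃ Φ : OpenPartialHomeomorph E (F × G), x ∈ Φ.source ∧ Φ.source ⊆ s ∧
      ContDiffOn ℝ ∞ Φ Φ.source ∧ ContDiffOn ℝ ∞ Φ.symm Φ.target ∧ ∀ y, (Φ y).1 = f y := by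
  have : CompleteSpace E := FiniteDimensional.complete ℝ E
  obtain ⟨g, e, he⟩ := exists_continuousLinearEquiv_fst_eq (G := G) hdim _ hsurj
  have hψ : ContDiffOn ℝ ∞ (fun y => (f y, g y)) s := hf.prodMk g.contDiff.contDiffOn
  have hfx : DifferentiableAt ℝ f x := (hf.contDiffAt (hs.mem_nhds hx)).differentiableAt (by simp)
  have hd : HasFDerivAt (fun y => (f y, g y)) (e : E →L[ℝ] F × G) x := by
    rw [he]
    exact hfx.hasFDerivAt.prodMk g.hasFDerivAt
  let Φ₀ := (hψ.contDiffAt (hs.mem_nhds hx)).toOpenPartialHomeomorph _ hd (by simp)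
  -- The inverse function theorem gives a smooth inverse only where the derivative is invertible.
  -- This is an open condition, so the source is cut down to it.
  let t : Set E := s ∩ fderiv ℝ (fun y => (f y, g y)) ⁻¹'
    range ((↑) : (E ≃L[ℝ] F × G) → (E →L[ℝ] F × G))
  have ht : IsOpen t := (hψ.continuousOn_fderiv_of_isOpen hs (by simp)).isOpen_inter_preimage hs
    (ContinuousLinearEquiv.isOpen (𝕜 := ℝ))
  refine ⟨Φ₀.restrOpen t ht, ⟨ContDiffAt.mem_toOpenPartialHomeomorph_source _ hd _,
    hx, e, hd.fderiv.symm⟩, fun y hy => hy.2.1, hψ.mono fun y hy => hy.2.1, ?_, fun y => rfl⟩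
  intro y hy
  obtain ⟨h1, e', he'⟩ := ((Φ₀.restrOpen t ht).map_target hy).2
  refine ((Φ₀.restrOpen t ht).contDiffAt_symm hy (f₀' := e') ?_
    (hψ.contDiffAt (hs.mem_nhds h1))).contDiffWithinAt
  rw [he']
  exact ((hψ.contDiffAt (hs.mem_nhds h1)).differentiableAt (by simp)).hasFDerivAt

end Calculus

/-! ### Differentials and brackets of real functions -/

section Hamiltonian

variable {d : ℕ} {M : Type u} [TopologicalSpace M] [ChartedSpace (EuclideanSpace ℝ (Fin d)) M]

theorem mvfderiv_apply_component {k : ℕ} {b : M → EuclideanSpace ℝ (Fin k)} {p : M}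
    (hb : MDifferentiableAt (𝓡 d) (𝓡 k) b p) (v : TangentSpace (𝓡 d) p) (i : Fin k) :
    mvfderiv (𝓡 d) b p v i = mvfderiv (𝓡 d) (fun q => b q i) p v := by
  have h := ((EuclideanSpace.proj i : EuclideanSpace ℝ (Fin k) →L[ℝ] ℝ).hasMFDerivAt
    (x := b p)).comp p hb.hasMFDerivAt
  exact (DFunLike.congr_fun h.mfderiv v).symm

theorem mvfderiv_ofReal {f : M → ℝ} {p : M} (hf : MDifferentiableAt (𝓡 d) 𝓘(ℝ, ℝ) f p)
    (v : TangentSpace (𝓡 d) p) :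
    mvfderiv (𝓡 d) (fun q => (f q : ℂ)) p v = (mvfderiv (𝓡 d) f p v : ℝ) := by
  have h := (Complex.ofRealCLM.hasMFDerivAt (x := f p)).comp p hf.hasMFDerivAt
  exact DFunLike.congr_fun h.mfderiv v

theorem SymplecticForm.hamiltonianField_zero (Ω : SymplecticForm d M) (p : M) :
    Ω.hamiltonianField (fun _ => 0) p = 0 := by
  have h : (mvfderiv (𝓡 d) (fun _ : M => (0 : ℝ)) p) = 0 := mvfderiv_const _
  rw [hamiltonianField, h]
  exact map_zero (Ω.flatEquiv p).symm

/-- The imaginary part of a real function has zero Hamiltonian field, so only the first term of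
`df(X_g)` survives. -/
theorem SymplecticForm.poissonBracket_ofReal (Ω : SymplecticForm d M) {f : M → ℂ} {g : M → ℝ}
    {p : M} (hf : MDifferentiableAt (𝓡 d) 𝓘(ℝ, ℂ) f p) :
    Ω.poissonBracket f (fun q => (g q : ℂ)) p = mvfderiv (𝓡 d) f p (Ω.hamiltonianField g p) := by
  simp [Ω.poissonBracket_eq hf, hamiltonianField_zero]

end Hamiltonian

/-! ### The kernel of a commuting submersion -/

section Polarization

variable {n : ℕ} {M : Type u} [TopologicalSpace M]
  [ChartedSpace (EuclideanSpace ℝ (Fin (2 * n))) M]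

/-- If `b` is a submersion onto `ℝ^n` at `p` with Poisson commuting components, then the kernel of
`db` at `p` is spanned by the Hamiltonian fields of the components. -/
theorem SymplecticForm.ker_le_span_hamiltonianField (Ω : SymplecticForm (2 * n) M)
    {b : M → EuclideanSpace ℝ (Fin n)} {p : M}
    (hb : MDifferentiableAt (𝓡 (2 * n)) (𝓡 n) b p)
    (hsurj : Function.Surjective (mvfderiv (𝓡 (2 * n)) b p))
    (hcomm : ∀ i j, mvfderiv (𝓡 (2 * n)) (fun q => b q i) p
      (Ω.hamiltonianField (fun q => b q j) p) = 0) :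
    (mvfderiv (𝓡 (2 * n)) b p).toLinearMap.ker ≤
      Submodule.span ℝ (range fun i => Ω.hamiltonianField (fun q => b q i) p) := by
  have hmem : ∀ j, Ω.hamiltonianField (fun q => b q j) p ∈
      (mvfderiv (𝓡 (2 * n)) b p).toLinearMap.ker := by
    intro j
    rw [LinearMap.mem_ker]
    ext i
    exact (mvfderiv_apply_component hb _ i).trans (hcomm i j)
  have hind : LinearIndependent ℝ fun i => Ω.hamiltonianField (fun q => b q i) p :=
    ((linearIndependent_components_iff _ (mvfderiv (𝓡 (2 * n)) b p).toLinearMap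
      fun v i => mvfderiv_apply_component hb v i).2 hsurj).map' _
      (Ω.flatEquiv p).symm.ker
  -- The dimension `2n` enters here: `2n - n = n` is exactly the number of independent Hamiltonian
  -- fields in the kernel.
  have hrank : Module.finrank ℝ (mvfderiv (𝓡 (2 * n)) b p).toLinearMap.ker = n := by
    have h1 := (mvfderiv (𝓡 (2 * n)) b p).toLinearMap.finrank_range_add_finrank_ker
    rw [LinearMap.range_eq_top.2 hsurj, finrank_top, finrank_euclideanSpace_fin] at h1
    have h2 : Module.finrank ℝ (TangentSpace (𝓡 (2 * n)) p) = 2 * n :=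
      finrank_euclideanSpace_fin (𝕜 := ℝ) (n := 2 * n)
    omega
  refine (Submodule.eq_of_le_of_finrank_le (Submodule.span_le.2 ?_) ?_).ge
  · rintro _ ⟨j, rfl⟩
    exact hmem j
  · rw [hrank, finrank_span_eq_card hind, Fintype.card_fin]

/-- By linearity in `v` it suffices that `Ω(X_f, w) = df(w)`. -/
theorem SymplecticForm.form_eq_zero_of_mem_span (Ω : SymplecticForm (2 * n) M)
    {ι : Type*} (f : ι → M → ℝ) {p : M} {v w : TangentSpace (𝓡 (2 * n)) p}
    (hv : v ∈ Submodule.span ℝ (range fun i => Ω.hamiltonianField (f i) p))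
    (hw : ∀ i, mvfderiv (𝓡 (2 * n)) (f i) p w = 0) :
    Ω.form p ![v, w] = 0 := by
  change Ω.flat p v w = 0
  induction hv using Submodule.span_induction with
  | mem x hx =>
    obtain ⟨i, rfl⟩ := hx
    exact (Ω.form_hamiltonianField (f i) p w).trans (hw i)
  | zero => simp
  | add x y _ _ hx hy => simp [hx, hy]
  | smul c x _ hx => simp [hx]

end Polarization

/-! ### Adapted boxes and their fibers -/

/-- A box adapted to a smooth map `b : M → ℝ^k`: an open subset of `M` identified with a product
of two balls in such a way that `b` becomes the first projection. -/
structure AdaptedBox (d : ℕ) {M : Type u} [TopologicalSpace M]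
    [ChartedSpace (EuclideanSpace ℝ (Fin d)) M] {k : ℕ} (b : M → EuclideanSpace ℝ (Fin k))
    (m : ℕ) where
  box : PartialDiffeomorph (𝓡 d) 𝓘(ℝ, EuclideanSpace ℝ (Fin k) × EuclideanSpace ℝ (Fin m)) M
    (EuclideanSpace ℝ (Fin k) × EuclideanSpace ℝ (Fin m)) ∞
  center : EuclideanSpace ℝ (Fin k) × EuclideanSpace ℝ (Fin m)
  radius : ℝ
  radius_pos : 0 < radius
  target_eq : box.target = ball center.1 radius ×ˢ ball center.2 radius
  fst_box : ∀ q ∈ box.source, (box q).1 = b q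

variable {d : ℕ} {M : Type u} [TopologicalSpace M] [ChartedSpace (EuclideanSpace ℝ (Fin d)) M]
  {k m : ℕ} {b : M → EuclideanSpace ℝ (Fin k)}

/-- A chart of `M` followed by the straightening of `b` has `b` as first component. Shrinking its
target to a ball suffices, since a ball for the sup norm is a product of balls of the same radius.
-/
theorem exists_adaptedBox [IsManifold (𝓡 d) ∞ M] (hd : d = k + m)
    (hb : ContMDiff (𝓡 d) (𝓡 k) ∞ b) (p : M)
    (hsurj : Function.Surjective (mvfderiv (𝓡 d) b p)) :
    ∃ B : AdaptedBox d b m, p ∈ B.box.source := by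
  let e := chartAt (EuclideanSpace ℝ (Fin d)) p
  have hpe : p ∈ e.source := mem_chart_source _ p
  have hesymm : ContMDiffOn (𝓡 d) (𝓡 d) ∞ e.symm e.target := contMDiffOn_chart_symm
  have hf : ContMDiffOn (𝓡 d) (𝓡 k) ∞ (b ∘ e.symm) e.target :=
    hb.comp_contMDiffOn hesymm
  have hs' : Function.Surjective (fderiv ℝ (b ∘ e.symm) (e p)) := by
    have h1 : MDifferentiableAt (𝓡 d) (𝓡 d) e.symm (e p) :=
      (hesymm.contMDiffAt (e.open_target.mem_nhds (e.map_source hpe))).mdifferentiableAt (by simp)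
    have h2 : MDifferentiableAt (𝓡 d) (𝓡 d) e p :=
      ((contMDiffOn_chart (I := 𝓡 d) (n := ∞)).contMDiffAt
        (e.open_source.mem_nhds hpe)).mdifferentiableAt (by simp)
    have h3 : MDifferentiableAt (𝓡 d) (𝓡 k) (b ∘ e.symm) (e p) :=
      (hf.contMDiffAt (e.open_target.mem_nhds (e.map_source hpe))).mdifferentiableAt (by simp)
    have h4 : mfderiv (𝓡 d) (𝓡 k) b p =
        (mfderiv (𝓡 d) (𝓡 k) (b ∘ e.symm) (e p)).comp (mfderiv (𝓡 d) (𝓡 d) e p) := by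
      rw [← mfderiv_comp p h3 h2]
      apply Filter.EventuallyEq.mfderiv_eq
      filter_upwards [e.open_source.mem_nhds hpe] with q hq
      simp [e.left_inv hq]
    have h5 : Function.Surjective (mfderiv (𝓡 d) (𝓡 k) b p) := hsurj
    rw [h4] at h5
    rw [← mfderiv_eq_fderiv]
    exact Function.Surjective.of_comp h5
  obtain ⟨Ψ, hxΨ, hΨs, hΨ, hΨsymm, hfst⟩ :=
    exists_openPartialHomeomorph_fst_eq (G := EuclideanSpace ℝ (Fin m)) (by simp [hd])
      e.open_target (e.map_source hpe) hf.contDiffOn hs'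
  let Φ := e.trans Ψ
  have hpΦ : p ∈ Φ.source := by simp [Φ, hpe, hxΨ]
  have hcomp : ContMDiffOn (𝓡 d) 𝓘(ℝ, EuclideanSpace ℝ (Fin k) × EuclideanSpace ℝ (Fin m)) ∞ Φ
      Φ.source :=
    hΨ.contMDiffOn.comp (contMDiffOn_chart.mono fun q hq => hq.1) fun q hq => hq.2
  have hsymm : ContMDiffOn 𝓘(ℝ, EuclideanSpace ℝ (Fin k) × EuclideanSpace ℝ (Fin m)) (𝓡 d) ∞
      Φ.symm Φ.target :=
    hesymm.comp (hΨsymm.contMDiffOn.mono fun y hy => hy.1) fun y hy => hy.2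
  obtain ⟨r, hr, hball⟩ := Metric.isOpen_iff.1 Φ.open_target (Φ p) (Φ.map_source hpΦ)
  -- The target, not the source, has to become a ball, so the inverse is restricted.
  let Φ' := (Φ.symm.restrOpen (ball (Φ p) r) isOpen_ball).symm
  have hsource : Φ'.source ⊆ Φ.source := by
    intro q hq
    have h1 := Φ'.map_source hq
    have h2 : Φ'.symm (Φ' q) ∈ Φ.source := Φ.map_target (h1 : _ ∈ Φ.target ∩ _).1
    rwa [Φ'.left_inv hq] at h2
  refine ⟨{ box := { toPartialEquiv := Φ'.toPartialEquiv
                     open_source := Φ'.open_source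
                     open_target := Φ'.open_target
                     contMDiffOn_toFun := hcomp.mono hsource
                     contMDiffOn_invFun := hsymm.mono fun y hy => hy.1 }
            center := Φ p
            radius := r
            radius_pos := hr
            target_eq := ?_
            fst_box := ?_ }, ?_⟩
  · change Φ.target ∩ ball (Φ p) r = _
    rw [inter_eq_self_of_subset_right hball, ball_prod_same]
  · intro q hq
    exact (hfst (e q)).trans (congrArg b (e.left_inv (hsource hq).1))
  · have h1 : Φ p ∈ Φ'.target := ⟨Φ.map_source hpΦ, mem_ball_self hr⟩
    have h2 : Φ.symm (Φ p) ∈ Φ'.source := Φ'.map_target h1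
    rwa [Φ.left_inv hpΦ] at h2

namespace AdaptedBox

variable (B : AdaptedBox d b m)

/-- The parametrization of the fiber of `b` over `x` in an adapted box. -/
def fiberParam (x : EuclideanSpace ℝ (Fin k)) (z : EuclideanSpace ℝ (Fin m)) : M :=
  B.box.invFun (x, z)

variable {B} {x : EuclideanSpace ℝ (Fin k)} {z : EuclideanSpace ℝ (Fin m)}

theorem mem_target (hx : x ∈ ball B.center.1 B.radius) (hz : z ∈ ball B.center.2 B.radius) :
    (x, z) ∈ B.box.target := by
  rw [B.target_eq]
  exact ⟨hx, hz⟩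

theorem fiberParam_mem (hx : x ∈ ball B.center.1 B.radius) (hz : z ∈ ball B.center.2 B.radius) :
    B.fiberParam x z ∈ B.box.source :=
  B.box.map_target (mem_target hx hz)

theorem box_fiberParam (hx : x ∈ ball B.center.1 B.radius)
    (hz : z ∈ ball B.center.2 B.radius) : B.box (B.fiberParam x z) = (x, z) :=
  B.box.right_inv (mem_target hx hz)

theorem apply_fiberParam (hx : x ∈ ball B.center.1 B.radius)
    (hz : z ∈ ball B.center.2 B.radius) : b (B.fiberParam x z) = x := by
  rw [← B.fst_box _ (fiberParam_mem hx hz), box_fiberParam hx hz]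

variable {q : M}

theorem box_mem (hq : q ∈ B.box.source) :
    b q ∈ ball B.center.1 B.radius ∧ (B.box q).2 ∈ ball B.center.2 B.radius := by
  have h : B.box q ∈ B.box.target := B.box.map_source hq
  rw [B.target_eq] at h
  rw [← B.fst_box q hq]
  exact h

theorem fiberParam_box (hq : q ∈ B.box.source) : B.fiberParam (b q) (B.box q).2 = q := by
  rw [← B.fst_box q hq]
  exact B.box.left_inv hq

theorem contMDiffOn_fiberParam_fst (hz : z ∈ ball B.center.2 B.radius) :
    ContMDiffOn (𝓡 k) (𝓡 d) ∞ (fun x => B.fiberParam x z) (ball B.center.1 B.radius) :=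
  B.box.contMDiffOn_invFun.comp
    (contDiff_id.prodMk contDiff_const).contMDiff.contMDiffOn fun _ hx => mem_target hx hz

theorem contMDiffOn_fiberParam (hx : x ∈ ball B.center.1 B.radius) :
    ContMDiffOn (𝓡 m) (𝓡 d) ∞ (B.fiberParam x) (ball B.center.2 B.radius) :=
  B.box.contMDiffOn_invFun.comp
    (contDiff_const.prodMk contDiff_id).contMDiff.contMDiffOn fun _ hz => mem_target hx hz

theorem contMDiffOn_snd_box :
    ContMDiffOn (𝓡 d) (𝓡 m) ∞ (fun q => (B.box q).2) B.box.source :=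
  contDiff_snd.contMDiff.comp_contMDiffOn B.box.contMDiffOn_toFun

theorem mdifferentiableAt_fiberParam (hx : x ∈ ball B.center.1 B.radius)
    (hz : z ∈ ball B.center.2 B.radius) :
    MDifferentiableAt (𝓡 m) (𝓡 d) (B.fiberParam x) z :=
  ((contMDiffOn_fiberParam hx).contMDiffAt (isOpen_ball.mem_nhds hz)).mdifferentiableAt (by simp)

theorem fiber_eq (hq : q ∈ B.box.source) :
    B.box.source ∩ b ⁻¹' {b q} = B.fiberParam (b q) '' ball B.center.2 B.radius := by
  ext q'
  constructor
  · rintro ⟨h1, h2⟩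
    exact ⟨_, (box_mem h1).2, by rw [← show b q' = b q from h2, fiberParam_box h1]⟩
  · rintro ⟨z, hz, rfl⟩
    exact ⟨fiberParam_mem (box_mem hq).1 hz, apply_fiberParam (box_mem hq).1 hz⟩

/-- The fibers of an adapted box are connected. -/
theorem connectedComponentIn_fiber (hq : q ∈ B.box.source) :
    connectedComponentIn (B.box.source ∩ b ⁻¹' {b q}) q = B.box.source ∩ b ⁻¹' {b q} := by
  refine IsPreconnected.connectedComponentIn ?_ ⟨hq, rfl⟩
  rw [fiber_eq hq]
  exact (convex_ball _ _).isPreconnected.image _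
    (contMDiffOn_fiberParam (box_mem hq).1).continuousOn

/-- Fixing the second box coordinate gives a section of `b` through `q`, whose derivative is a right
inverse of `db`. Thus `b` is a submersion on the whole box without further shrinking. -/
theorem surjective_mvfderiv (hb : ContMDiff (𝓡 d) (𝓡 k) ∞ b) (hq : q ∈ B.box.source) :
    Function.Surjective (mvfderiv (𝓡 d) b q) := by
  obtain ⟨h1, h2⟩ := box_mem hq
  have hσ : MDifferentiableAt (𝓡 k) (𝓡 d) (fun x => B.fiberParam x (B.box q).2) (b q) :=
    ((contMDiffOn_fiberParam_fst h2).contMDiffAt (isOpen_ball.mem_nhds h1)).mdifferentiableAt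
      (by simp)
  have hb' : MDifferentiableAt (𝓡 d) (𝓡 k) b (B.fiberParam (b q) (B.box q).2) :=
    hb.mdifferentiableAt (by simp)
  have h3 := mfderiv_comp (b q) hb' hσ
  have h4 : mfderiv (𝓡 k) (𝓡 k) (b ∘ fun x => B.fiberParam x (B.box q).2) (b q) =
      mfderiv (𝓡 k) (𝓡 k) id (b q) := by
    apply Filter.EventuallyEq.mfderiv_eq
    filter_upwards [isOpen_ball.mem_nhds h1] with x hx
    exact apply_fiberParam hx h2
  rw [h4, mfderiv_id, fiberParam_box hq] at h3
  intro y
  exact ⟨mfderiv (𝓡 k) (𝓡 d) (fun x => B.fiberParam x (B.box q).2) (b q) y,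
    (DFunLike.congr_fun h3 y).symm⟩

/-- A smooth map whose differential vanishes on the kernel of `db` is constant on the fibers of
`b` in an adapted box. -/
theorem eq_of_apply_eq {W : Type*} [NormedAddCommGroup W] [NormedSpace ℝ W]
    (hb : ContMDiff (𝓡 d) (𝓡 k) ∞ b) {a : M → W} (ha : ContMDiff (𝓡 d) 𝓘(ℝ, W) ∞ a)
    (hab : ∀ q ∈ B.box.source, ∀ v, mvfderiv (𝓡 d) b q v = 0 → mvfderiv (𝓡 d) a q v = 0)
    {q q' : M} (hq : q ∈ B.box.source) (hq' : q' ∈ B.box.source) (h : b q = b q') :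
    a q = a q' := by
  have hx := (box_mem hq).1
  have hd : DifferentiableOn ℝ (a ∘ B.fiberParam (b q)) (ball B.center.2 B.radius) :=
    (ha.comp_contMDiffOn (contMDiffOn_fiberParam hx)).contDiffOn.differentiableOn (by simp)
  -- `b` is constant along the parametrized fiber, so the velocities of the fiber lie in the kernel
  -- of `db`, where `da` vanishes.
  have hz : (ball B.center.2 B.radius).EqOn (fderiv ℝ (a ∘ B.fiberParam (b q))) 0 := by
    intro z hz
    have hσ := mdifferentiableAt_fiberParam hx hz
    have h1 := mfderiv_comp z
      (hb.mdifferentiableAt (by simp) : MDifferentiableAt (𝓡 d) (𝓡 k) b _) hσ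
    have h2 := mfderiv_comp z
      (ha.mdifferentiableAt (by simp) : MDifferentiableAt (𝓡 d) 𝓘(ℝ, W) a _) hσ
    have h3 : mfderiv (𝓡 m) (𝓡 k) (b ∘ B.fiberParam (b q)) z = 0 := by
      have h4 : b ∘ B.fiberParam (b q) =ᶠ[nhds z] fun _ => b q := by
        filter_upwards [isOpen_ball.mem_nhds hz] with y hy
        exact apply_fiberParam hx hy
      rw [mfderiv_eq_fderiv, h4.fderiv_eq]
      exact fderiv_const_apply _
    rw [← mfderiv_eq_fderiv, h2]
    ext v
    refine hab _ (fiberParam_mem hx hz) _ ?_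
    rw [h3] at h1
    exact (DFunLike.congr_fun h1 v).symm
  have := isOpen_ball.is_const_of_fderiv_eq_zero (convex_ball _ _).isPreconnected hd hz
    (box_mem hq).2 (box_mem hq').2
  rw [Function.comp_apply, Function.comp_apply, fiberParam_box hq, h, fiberParam_box hq'] at this
  exact this

/-! ### Foliated charts from boxes -/

variable (B) in
/-- The foliated chart defined by an adapted box. -/
def foliatedChart (hb : ContMDiff (𝓡 d) (𝓡 k) ∞ b) : FoliatedChart d M k where
  domain := B.box.source
  toFun := b
  isOpen_domain := B.box.open_source
  isOpen_image := by
    have : b '' B.box.source = ball B.center.1 B.radius := by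
      ext x
      constructor
      · rintro ⟨q, hq, rfl⟩
        exact (box_mem hq).1
      · intro hx
        have hz := mem_ball_self (x := B.center.2) B.radius_pos
        exact ⟨_, fiberParam_mem hx hz, apply_fiberParam hx hz⟩
    rw [this]
    exact isOpen_ball
  contMDiffOn := hb.contMDiffOn
  submersion _ hp := surjective_mvfderiv hb hp

variable (B) in
theorem isOpen_image {s : Set M} (hs : IsOpen s)
    (hsB : s ⊆ B.box.source) : IsOpen (b '' s) := by
  have h1 : b '' s = Prod.fst '' (B.box.toOpenPartialHomeomorph '' s) := by
    rw [image_image]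
    exact image_congr fun q hq => (B.fst_box q (hsB hq)).symm
  rw [h1]
  exact isOpenMap_fst _ (B.box.toOpenPartialHomeomorph.isOpen_image_of_subset_source hs hsB)

variable (B) in
/-- The foliated charts of two adapted boxes are compatible if each of the two coordinate maps is
constant on the fibers of the other one. -/
theorem compatible_foliatedChart {c : M → EuclideanSpace ℝ (Fin k)} (C : AdaptedBox d c m)
    (hb : ContMDiff (𝓡 d) (𝓡 k) ∞ b) (hc : ContMDiff (𝓡 d) (𝓡 k) ∞ c)
    (hbc : ∀ q ∈ B.box.source, ∀ q' ∈ B.box.source, b q = b q' → c q = c q')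
    (hcb : ∀ q ∈ C.box.source, ∀ q' ∈ C.box.source, c q = c q' → b q = b q') :
    (B.foliatedChart hb).Compatible (C.foliatedChart hc) := by
  -- The transition map is `c` along the central section of `B`. That section may leave the overlap
  -- of the boxes, but `c` is defined on all of `M` and constant on the fibers of `B`, so the value
  -- is still `c q`.
  have hB : ∀ q ∈ B.box.source, c (B.fiberParam (b q) B.center.2) = c q := fun q hq =>
    have h1 := (box_mem hq).1
    have h2 := mem_ball_self (x := B.center.2) B.radius_pos
    hbc _ (fiberParam_mem h1 h2) _ hq (apply_fiberParam h1 h2)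
  have hC : ∀ q ∈ C.box.source, b (C.fiberParam (c q) C.center.2) = b q := fun q hq =>
    have h1 := (box_mem hq).1
    have h2 := mem_ball_self (x := C.center.2) C.radius_pos
    hcb _ (fiberParam_mem h1 h2) _ hq (apply_fiberParam h1 h2)
  have hopen := B.box.open_source.inter C.box.open_source
  refine ⟨{ toFun := fun x => c (B.fiberParam x B.center.2)
            invFun := fun y => b (C.fiberParam y C.center.2)
            source := b '' (B.box.source ∩ C.box.source)
            target := c '' (B.box.source ∩ C.box.source)
            map_source' := ?_
            map_target' := ?_
            left_inv' := ?_
            right_inv' := ?_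
            open_source := B.isOpen_image hopen inter_subset_left
            open_target := C.isOpen_image hopen inter_subset_right
            contMDiffOn_toFun := ?_
            contMDiffOn_invFun := ?_ }, rfl, rfl, fun p hp => hB p hp.1⟩
  · rintro _ ⟨q, hq, rfl⟩
    exact ⟨q, hq, (hB q hq.1).symm⟩
  · rintro _ ⟨q, hq, rfl⟩
    exact ⟨q, hq, (hC q hq.2).symm⟩
  · rintro _ ⟨q, hq, rfl⟩
    simp only [hB q hq.1, hC q hq.2]
  · rintro _ ⟨q, hq, rfl⟩
    simp only [hB q hq.1, hC q hq.2]
  · refine hc.comp_contMDiffOn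
      ((contMDiffOn_fiberParam_fst (mem_ball_self B.radius_pos)).mono ?_)
    rintro _ ⟨q, hq, rfl⟩
    exact (box_mem hq.1).1
  · refine hb.comp_contMDiffOn
      ((contMDiffOn_fiberParam_fst (mem_ball_self C.radius_pos)).mono ?_)
    rintro _ ⟨q, hq, rfl⟩
    exact (box_mem hq.2).1

end AdaptedBox

/-! ### Sets that are locally a fiber, as immersed manifolds -/

section LevelSet

variable {d : ℕ} {M : Type u} [TopologicalSpace M] [ChartedSpace (EuclideanSpace ℝ (Fin d)) M]
  {k m : ℕ} {b : M → EuclideanSpace ℝ (Fin k)}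

namespace AdaptedBox

open Classical in
/-- The chart of a set `L ⊆ M` at a point `q`, in an adapted box in which `L` is the fiber of `b`
through `q`. -/
noncomputable def levelChart (B : AdaptedBox d b m) {L : Set M} (q : L)
    (hq : (q : M) ∈ B.box.source) (hL : ∀ q' ∈ B.box.source, q' ∈ L ↔ b q' = b q) :
    OpenPartialHomeomorph L (EuclideanSpace ℝ (Fin m)) where
  toFun y := (B.box y).2
  invFun z := if h : B.fiberParam (b q) z ∈ L then ⟨B.fiberParam (b q) z, h⟩ else q
  source := Subtype.val ⁻¹' B.box.source
  target := ball B.center.2 B.radius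
  map_source' _ hy := (box_mem hy).2
  map_target' z hz := by
    have h1 := fiberParam_mem (box_mem hq).1 hz
    rw [dif_pos ((hL _ h1).2 (apply_fiberParam (box_mem hq).1 hz))]
    exact h1
  left_inv' y hy := by
    have h : B.fiberParam (b q) (B.box y).2 = y := by
      rw [← (hL y hy).1 y.2, fiberParam_box hy]
    apply Subtype.ext
    rw [dif_pos (show B.fiberParam (b q) (B.box y).2 ∈ L by rw [h]; exact y.2)]
    exact h
  right_inv' z hz := by
    have h1 := fiberParam_mem (box_mem hq).1 hz
    rw [dif_pos ((hL _ h1).2 (apply_fiberParam (box_mem hq).1 hz)),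
      box_fiberParam (box_mem hq).1 hz]
  open_source := B.box.open_source.preimage continuous_subtype_val
  open_target := isOpen_ball
  continuousOn_toFun := contMDiffOn_snd_box.continuousOn.comp
    continuous_subtype_val.continuousOn fun _ hy => hy
  continuousOn_invFun := by
    rw [Topology.IsInducing.subtypeVal.continuousOn_iff]
    refine (contMDiffOn_fiberParam (box_mem hq).1).continuousOn.congr fun z hz => ?_
    rw [Function.comp_apply, dif_pos ((hL _ (fiberParam_mem (box_mem hq).1 hz)).2
      (apply_fiberParam (box_mem hq).1 hz))]

theorem coe_levelChart_symm (B : AdaptedBox d b m) {L : Set M} (q : L)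
    (hq : (q : M) ∈ B.box.source) (hL : ∀ q' ∈ B.box.source, q' ∈ L ↔ b q' = b q)
    {z : EuclideanSpace ℝ (Fin m)} (hz : z ∈ ball B.center.2 B.radius) :
    ((B.levelChart q hq hL).symm z : M) = B.fiberParam (b q) z := by
  have h1 := fiberParam_mem (box_mem hq).1 hz
  exact congrArg Subtype.val (dif_pos ((hL _ h1).2 (apply_fiberParam (box_mem hq).1 hz)))

end AdaptedBox

variable {L : Set M} {c : L → M → EuclideanSpace ℝ (Fin k)} (B : ∀ q : L, AdaptedBox d (c q) m)
  (hB : ∀ q : L, (q : M) ∈ (B q).box.source)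
  (hL : ∀ (q : L), ∀ q' ∈ (B q).box.source, q' ∈ L ↔ c q q' = c q q)

/-- The charted space structure on a set that is locally a fiber of an adapted box. -/
@[reducible]
noncomputable def levelChartedSpace : ChartedSpace (EuclideanSpace ℝ (Fin m)) L where
  atlas := range fun q => (B q).levelChart q (hB q) (hL q)
  chartAt q := (B q).levelChart q (hB q) (hL q)
  mem_chart_source q := hB q
  chart_mem_atlas q := mem_range_self q

/-- A change of charts is the fiber parametrization of one box followed by the second coordinate of
another, both smooth as maps into and out of `M`. -/
theorem isManifold_levelChartedSpace :
    letI := levelChartedSpace B hB hL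
    IsManifold (𝓡 m) ∞ L := by
  let := levelChartedSpace B hB hL
  apply isManifold_of_contDiffOn
  rintro _ _ ⟨q, rfl⟩ ⟨q', rfl⟩
  rw [← contMDiffOn_iff_contDiffOn]
  refine ((AdaptedBox.contMDiffOn_snd_box (B := B q')).comp
    (s := {z | z ∈ ball (B q).center.2 (B q).radius ∧
      (B q).fiberParam (c q q) z ∈ (B q').box.source})
    ((AdaptedBox.contMDiffOn_fiberParam (AdaptedBox.box_mem (hB q)).1).mono fun z hz => hz.1)
    fun z hz => hz.2).congr_mono ?_ ?_
  · rintro z ⟨⟨hz, -⟩, -⟩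
    exact congrArg (fun p => ((B q').box p).2)
      ((B q).coe_levelChart_symm q (hB q) (hL q) hz)
  · rintro z ⟨⟨hz, hz'⟩, -⟩
    refine ⟨hz, ?_⟩
    have h := (B q).coe_levelChart_symm q (hB q) (hL q) hz
    exact h ▸ hz'

/-- Near `x` the inclusion is the chart followed by the fiber parametrization of its box. -/
theorem contMDiff_subtypeVal_level :
    letI := levelChartedSpace B hB hL
    ContMDiff (𝓡 m) (𝓡 d) ∞ (Subtype.val : L → M) := by
  let := levelChartedSpace B hB hL
  have := isManifold_levelChartedSpace B hB hL
  intro x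
  have hx := AdaptedBox.box_mem (hB x)
  have h1 : ContMDiffAt (𝓡 m) (𝓡 m) ∞ (chartAt (EuclideanSpace ℝ (Fin m)) x) x :=
    contMDiffOn_chart.contMDiffAt ((chartAt _ x).open_source.mem_nhds (mem_chart_source _ x))
  have h2 : ContMDiffAt (𝓡 m) (𝓡 d) ∞ ((B x).fiberParam (c x x))
      (chartAt (EuclideanSpace ℝ (Fin m)) x x) :=
    (AdaptedBox.contMDiffOn_fiberParam hx.1).contMDiffAt (isOpen_ball.mem_nhds hx.2)
  refine (h2.comp x h1).congr_of_eventuallyEq ?_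
  filter_upwards [(chartAt (EuclideanSpace ℝ (Fin m)) x).open_source.mem_nhds
    (mem_chart_source _ x)] with y hy
  have h3 := (B x).coe_levelChart_symm x (hB x) (hL x) ((chartAt _ x).map_source hy)
  rw [Function.comp_apply, ← h3]
  exact congrArg Subtype.val ((chartAt _ x).left_inv hy).symm

theorem injective_mfderiv_subtypeVal_level (x : L) :
    letI := levelChartedSpace B hB hL
    Function.Injective (mfderiv (𝓡 m) (𝓡 d) (Subtype.val : L → M) x) := by
  let := levelChartedSpace B hB hL
  have := isManifold_levelChartedSpace B hB hL
  let e := chartAt (EuclideanSpace ℝ (Fin m)) x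
  have hxe : x ∈ e.source := mem_chart_source _ x
  have hι : MDifferentiableAt (𝓡 m) (𝓡 d) (Subtype.val : L → M) x :=
    (contMDiff_subtypeVal_level B hB hL).mdifferentiableAt (by simp)
  have h1 : MDifferentiableAt (𝓡 d) (𝓡 m) (fun q => ((B x).box q).2) (x : M) :=
    (AdaptedBox.contMDiffOn_snd_box.contMDiffAt
      ((B x).box.open_source.mem_nhds (hB x))).mdifferentiableAt (by simp)
  have h2 : MDifferentiableAt (𝓡 m) (𝓡 m) e x :=
    (contMDiffOn_chart (I := 𝓡 m) (n := ∞)).contMDiffAt (e.open_source.mem_nhds hxe)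
      |>.mdifferentiableAt (by simp)
  have h3 : MDifferentiableAt (𝓡 m) (𝓡 m) e.symm (e x) :=
    (contMDiffOn_chart_symm (I := 𝓡 m) (n := ∞)).contMDiffAt
      (e.open_target.mem_nhds (e.map_source hxe)) |>.mdifferentiableAt (by simp)
  -- By definition the chart `e` is the inclusion followed by the second box coordinate. As `e` has
  -- a smooth local inverse, the derivative of the inclusion has a left inverse.
  have h4 : mfderiv (𝓡 m) (𝓡 m) e x = _ := mfderiv_comp (f := (Subtype.val : L → M)) x h1 hι
  have h5 := mfderiv_comp x h3 h2
  have h6 : mfderiv (𝓡 m) (𝓡 m) (e.symm ∘ e) x = mfderiv (𝓡 m) (𝓡 m) id x := by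
    apply Filter.EventuallyEq.mfderiv_eq
    filter_upwards [e.open_source.mem_nhds hxe] with y hy
    exact e.left_inv hy
  rw [h6, mfderiv_id, h4] at h5
  intro v w hvw
  exact (DFunLike.congr_fun h5 v).trans ((congrArg (fun u => mfderiv (𝓡 m) (𝓡 m) e.symm (e x)
    (mfderiv (𝓡 d) (𝓡 m) (fun q => ((B x).box q).2) (x : M) u)) hvw).trans
    (DFunLike.congr_fun h5 w).symm)

/-- Near `x` the map `c x` is constant on `L`. -/
theorem mvfderiv_mfderiv_subtypeVal_level (hc : ∀ q, ContMDiff (𝓡 d) (𝓡 k) ∞ (c q)) (x : L) :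
    letI := levelChartedSpace B hB hL
    ∀ v, mvfderiv (𝓡 d) (c x) (x : M) (mfderiv (𝓡 m) (𝓡 d) (Subtype.val : L → M) x v) = 0 := by
  let := levelChartedSpace B hB hL
  intro v
  have hι : MDifferentiableAt (𝓡 m) (𝓡 d) (Subtype.val : L → M) x :=
    (contMDiff_subtypeVal_level B hB hL).mdifferentiableAt (by simp)
  have h1 := mfderiv_comp x ((hc x).mdifferentiableAt (by simp)) hι
  have h2 : mfderiv (𝓡 m) (𝓡 k) (c x ∘ Subtype.val) x =
      mfderiv (𝓡 m) (𝓡 k) (fun _ : L => c x x) x := by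
    apply Filter.EventuallyEq.mfderiv_eq
    filter_upwards [((B x).box.open_source.preimage continuous_subtype_val).mem_nhds (hB x)]
      with y hy
    exact (hL x y hy).1 y.2
  rw [h2, mfderiv_const] at h1
  exact (DFunLike.congr_fun h1 v).symm

end LevelSet

/-- A set that is locally a fiber of an adapted box, with isotropic tangent spaces, is a
Lagrangian submanifold. -/
theorem isLagrangianSubmanifold_of_adaptedBox {n : ℕ} {M : Type u} [TopologicalSpace M]
    [T2Space M] [SecondCountableTopology M] [ChartedSpace (EuclideanSpace ℝ (Fin (2 * n))) M]
    (Ω : SymplecticForm (2 * n) M) {L : Set M} {c : L → M → EuclideanSpace ℝ (Fin n)}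
    (hc : ∀ q, ContMDiff (𝓡 (2 * n)) (𝓡 n) ∞ (c q)) (B : ∀ q : L, AdaptedBox (2 * n) (c q) n)
    (hB : ∀ q : L, (q : M) ∈ (B q).box.source)
    (hL : ∀ (q : L), ∀ q' ∈ (B q).box.source, q' ∈ L ↔ c q q' = c q q)
    (hΩ : ∀ (q : L) (v w), mvfderiv (𝓡 (2 * n)) (c q) (q : M) v = 0 →
      mvfderiv (𝓡 (2 * n)) (c q) (q : M) w = 0 → Ω.form q ![v, w] = 0) :
    IsLagrangianSubmanifold Ω L :=
  -- The manifold is `L` with its subspace topology, so separation and countability come from `M`.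
  ⟨L, inferInstance, levelChartedSpace B hB hL, Subtype.val, isManifold_levelChartedSpace B hB hL,
    inferInstance, inferInstance, contMDiff_subtypeVal_level B hB hL, Subtype.val_injective,
    injective_mfderiv_subtypeVal_level B hB hL, Subtype.range_val, fun x v w =>
    hΩ x _ _ (mvfderiv_mfderiv_subtypeVal_level B hB hL hc x v)
      (mvfderiv_mfderiv_subtypeVal_level B hB hL hc x w)⟩

/-! ### Chains of plaques -/

section Leaves

variable {d : ℕ} {M : Type u} [TopologicalSpace M] [ChartedSpace (EuclideanSpace ℝ (Fin d)) M]
  {k : ℕ} {F : Foliation d M k}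

theorem Foliation.Rel.trans_plaque {x y z : M} (h : F.Rel x y) {P : Set M} (hP : F.IsPlaque P)
    (hy : y ∈ P) (hz : z ∈ P) : F.Rel x z := by
  obtain ⟨l, Q, hQ, hx, hyl, hchain⟩ := h
  refine ⟨l + 1, Function.update Q (l + 1) P, ?_, ?_, ?_, ?_⟩
  · intro j hj
    rcases eq_or_ne j (l + 1) with rfl | hne
    · simpa using hP
    · rw [Function.update_of_ne hne]
      exact hQ j (by omega)
  · rwa [Function.update_of_ne (by omega)]
  · simpa using hz
  · intro j hj
    rw [Function.update_of_ne (by omega : j ≠ l + 1)]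
    rcases eq_or_ne j l with rfl | hne
    · exact ⟨y, hyl, by simpa using hy⟩
    · rw [Function.update_of_ne (by omega)]
      exact hchain j (by omega)

/-- A function that is constant on the plaques is constant on the leaves. -/
theorem Foliation.Rel.apply_eq {W : Type*} {f : M → W}
    (hf : ∀ P, F.IsPlaque P → ∀ x ∈ P, ∀ y ∈ P, f x = f y) {x y : M} (h : F.Rel x y) :
    f x = f y := by
  obtain ⟨l, P, hP, hx, hy, hchain⟩ := h
  have key : ∀ j ≤ l, ∀ z ∈ P j, f x = f z := by
    intro j
    induction j with
    | zero => exact fun _ z hz => hf _ (hP 0 (Nat.zero_le _)) x hx z hz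
    | succ j ih =>
      intro hj z hz
      obtain ⟨w, hw, hw'⟩ := hchain j (by omega)
      exact (ih (by omega) w hw).trans (hf _ (hP _ hj) w hw' z hz)
  exact key l le_rfl y hy

end Leaves

/-! ### The foliation of a commuting space of functions -/

section CommutingFunctions

variable {n : ℕ} {M : Type u} [TopologicalSpace M]
  [ChartedSpace (EuclideanSpace ℝ (Fin (2 * n))) M] {Ω : SymplecticForm (2 * n) M}
  {A : Submodule ℂ (M → ℂ)} {b : M → EuclideanSpace ℝ (Fin n)} {p : M}

theorem mvfderiv_hamiltonianField_component (hA : A ≤ smoothFunctions (2 * n) M)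
    (hcomm : ∀ a ∈ A, ∀ b ∈ A, ∀ p : M, Ω.poissonBracket a b p = 0)
    (hbA : ∀ i, (fun q => (b q i : ℂ)) ∈ A) {a : M → ℂ} (ha : a ∈ A) (i : Fin n) :
    mvfderiv (𝓡 (2 * n)) a p (Ω.hamiltonianField (fun q => b q i) p) = 0 := by
  have ha' : ContMDiff (𝓡 (2 * n)) 𝓘(ℝ, ℂ) ∞ a := hA ha
  rw [← Ω.poissonBracket_ofReal (ha'.mdifferentiableAt (by simp))]
  exact hcomm a ha _ (hbA i) p

theorem contMDiff_component (hb : ContMDiff (𝓡 (2 * n)) (𝓡 n) ∞ b) (i : Fin n) :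
    ContMDiff (𝓡 (2 * n)) 𝓘(ℝ, ℝ) ∞ fun q => b q i :=
  (EuclideanSpace.proj i : EuclideanSpace ℝ (Fin n) →L[ℝ] ℝ).contDiff.contMDiff.comp hb

theorem ker_le_span_hamiltonianField_of_commute (hA : A ≤ smoothFunctions (2 * n) M)
    (hcomm : ∀ a ∈ A, ∀ b ∈ A, ∀ p : M, Ω.poissonBracket a b p = 0)
    (hb : ContMDiff (𝓡 (2 * n)) (𝓡 n) ∞ b) (hbA : ∀ i, (fun q => (b q i : ℂ)) ∈ A)
    (hsurj : Function.Surjective (mvfderiv (𝓡 (2 * n)) b p)) :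
    (mvfderiv (𝓡 (2 * n)) b p).toLinearMap.ker ≤
      Submodule.span ℝ (range fun i => Ω.hamiltonianField (fun q => b q i) p) := by
  refine Ω.ker_le_span_hamiltonianField (hb.mdifferentiableAt (by simp)) hsurj fun i j => ?_
  have h := mvfderiv_hamiltonianField_component (p := p) hA hcomm hbA (hbA i) j
  rw [mvfderiv_ofReal ((contMDiff_component hb i).mdifferentiableAt (by simp))] at h
  exact Complex.ofReal_eq_zero.1 h

/-- The kernel of `db` is spanned by the Hamiltonian fields of the components of `b`, and `da` of
such a field is a bracket of two elements of `A`. -/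
theorem mvfderiv_eq_zero_of_commute (hA : A ≤ smoothFunctions (2 * n) M)
    (hcomm : ∀ a ∈ A, ∀ b ∈ A, ∀ p : M, Ω.poissonBracket a b p = 0)
    (hb : ContMDiff (𝓡 (2 * n)) (𝓡 n) ∞ b) (hbA : ∀ i, (fun q => (b q i : ℂ)) ∈ A)
    (hsurj : Function.Surjective (mvfderiv (𝓡 (2 * n)) b p)) {a : M → ℂ} (ha : a ∈ A)
    {v : TangentSpace (𝓡 (2 * n)) p} (hv : mvfderiv (𝓡 (2 * n)) b p v = 0) :
    mvfderiv (𝓡 (2 * n)) a p v = 0 := by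
  have hle : Submodule.span ℝ (range fun i => Ω.hamiltonianField (fun q => b q i) p) ≤
      (mvfderiv (𝓡 (2 * n)) a p).toLinearMap.ker := by
    rw [Submodule.span_le]
    rintro _ ⟨i, rfl⟩
    exact mvfderiv_hamiltonianField_component hA hcomm hbA ha i
  exact hle (ker_le_span_hamiltonianField_of_commute hA hcomm hb hbA hsurj hv)

theorem form_eq_zero_of_commute (hA : A ≤ smoothFunctions (2 * n) M)
    (hcomm : ∀ a ∈ A, ∀ b ∈ A, ∀ p : M, Ω.poissonBracket a b p = 0)
    (hb : ContMDiff (𝓡 (2 * n)) (𝓡 n) ∞ b) (hbA : ∀ i, (fun q => (b q i : ℂ)) ∈ A)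
    (hsurj : Function.Surjective (mvfderiv (𝓡 (2 * n)) b p))
    {v w : TangentSpace (𝓡 (2 * n)) p} (hv : mvfderiv (𝓡 (2 * n)) b p v = 0)
    (hw : mvfderiv (𝓡 (2 * n)) b p w = 0) : Ω.form p ![v, w] = 0 := by
  refine Ω.form_eq_zero_of_mem_span _
    (ker_le_span_hamiltonianField_of_commute hA hcomm hb hbA hsurj hv) fun i => ?_
  rw [← mvfderiv_apply_component (hb.mdifferentiableAt (by simp)), hw]
  rfl

theorem apply_eq_of_commute (hA : A ≤ smoothFunctions (2 * n) M)
    (hcomm : ∀ a ∈ A, ∀ b ∈ A, ∀ p : M, Ω.poissonBracket a b p = 0)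
    (hb : ContMDiff (𝓡 (2 * n)) (𝓡 n) ∞ b) (hbA : ∀ i, (fun q => (b q i : ℂ)) ∈ A)
    (B : AdaptedBox (2 * n) b n) {a : M → ℂ} (ha : a ∈ A) {q q' : M} (hq : q ∈ B.box.source)
    (hq' : q' ∈ B.box.source) (h : b q = b q') : a q = a q' :=
  AdaptedBox.eq_of_apply_eq hb (hA ha) (fun _ hx _ hv => mvfderiv_eq_zero_of_commute hA hcomm hb
    hbA (AdaptedBox.surjective_mvfderiv hb hx) ha hv) hq hq' h

theorem exists_adaptedBox_of_rich [IsManifold (𝓡 (2 * n)) ∞ M]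
    (hA : A ≤ smoothFunctions (2 * n) M) {a : Fin n → M → ℝ}
    (ha : ∀ i, (fun q => (a i q : ℂ)) ∈ A)
    (hind : LinearIndependent ℝ fun i => mvfderiv (𝓡 (2 * n)) (a i) p) :
    ∃ b : M → EuclideanSpace ℝ (Fin n), ContMDiff (𝓡 (2 * n)) (𝓡 n) ∞ b ∧
      (∀ i, (fun q => (b q i : ℂ)) ∈ A) ∧ ∃ B : AdaptedBox (2 * n) b n, p ∈ B.box.source := by
  have hb : ContMDiff (𝓡 (2 * n)) (𝓡 n) ∞ fun q => WithLp.toLp 2 fun i => a i q := by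
    -- Each `a i` is smooth, being the real part of an element of `A`.
    have h1 : ContMDiff (𝓡 (2 * n)) 𝓘(ℝ, Fin n → ℝ) ∞ fun q i => a i q :=
      contMDiff_pi_space.2 fun i => Complex.reCLM.contDiff.contMDiff.comp (hA (ha i))
    exact (EuclideanSpace.equiv (Fin n) ℝ).symm.contDiff.contMDiff.comp h1
  refine ⟨_, hb, ha, exists_adaptedBox (two_mul n) hb p ?_⟩
  have h2 : LinearIndependent ℝ fun i => (mvfderiv (𝓡 (2 * n)) (a i) p).toLinearMap :=
    hind.map' (ContinuousLinearMap.coeLM ℝ)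
      (LinearMap.ker_eq_bot.2 ContinuousLinearMap.coe_injective)
  exact (linearIndependent_components_iff _ (mvfderiv (𝓡 (2 * n)) _ p).toLinearMap
    fun v i => mvfderiv_apply_component (hb.mdifferentiableAt (by simp)) v i).1 h2

variable (A) in
/-- The foliated charts whose coordinates are real elements of `A` and whose domains are adapted
boxes. -/
def commutingCharts : Set (FoliatedChart (2 * n) M n) :=
  {φ | ∃ (b : M → EuclideanSpace ℝ (Fin n)) (hb : ContMDiff (𝓡 (2 * n)) (𝓡 n) ∞ b)
    (_ : ∀ i, (fun q => (b q i : ℂ)) ∈ A) (B : AdaptedBox (2 * n) b n), φ = B.foliatedChart hb}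

/-- The foliation defined by a commuting space of functions with sufficiently many independent
real elements. -/
def commutingFoliation [IsManifold (𝓡 (2 * n)) ∞ M] (hA : A ≤ smoothFunctions (2 * n) M)
    (hcomm : ∀ a ∈ A, ∀ b ∈ A, ∀ p : M, Ω.poissonBracket a b p = 0)
    (hrich : ∀ p : M, ∃ a : Fin n → M → ℝ, (∀ i, (fun q => (a i q : ℂ)) ∈ A) ∧
      LinearIndependent ℝ (fun i => mvfderiv (𝓡 (2 * n)) (a i) p)) :
    Foliation (2 * n) M n where
  charts := commutingCharts A
  compatible := by
    rintro _ ⟨b, hb, hbA, B, rfl⟩ _ ⟨c, hc, hcA, C, rfl⟩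
    refine B.compatible_foliatedChart C hb hc (fun q hq q' hq' h => ?_) fun q hq q' hq' h => ?_
    · ext i
      exact Complex.ofReal_injective (apply_eq_of_commute hA hcomm hb hbA B (hcA i) hq hq' h)
    · ext i
      exact Complex.ofReal_injective (apply_eq_of_commute hA hcomm hc hcA C (hbA i) hq hq' h)
  cover p := by
    obtain ⟨a, ha, hind⟩ := hrich p
    obtain ⟨b, hb, hbA, B, hp⟩ := exists_adaptedBox_of_rich hA ha hind
    exact ⟨_, ⟨b, hb, hbA, B, rfl⟩, hp⟩

variable [IsManifold (𝓡 (2 * n)) ∞ M] (hA : A ≤ smoothFunctions (2 * n) M)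
  (hcomm : ∀ a ∈ A, ∀ b ∈ A, ∀ p : M, Ω.poissonBracket a b p = 0)
  (hrich : ∀ p : M, ∃ a : Fin n → M → ℝ, (∀ i, (fun q => (a i q : ℂ)) ∈ A) ∧
    LinearIndependent ℝ (fun i => mvfderiv (𝓡 (2 * n)) (a i) p))

/-- Fibers of a box are connected, so each is a single plaque. -/
theorem commutingFoliation_isPlaque_iff {P : Set M} :
    (commutingFoliation hA hcomm hrich).IsPlaque P ↔
      ∃ (b : M → EuclideanSpace ℝ (Fin n)) (_ : ContMDiff (𝓡 (2 * n)) (𝓡 n) ∞ b)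
        (_ : ∀ i, (fun q => (b q i : ℂ)) ∈ A) (B : AdaptedBox (2 * n) b n),
        ∃ q ∈ B.box.source, P = B.box.source ∩ b ⁻¹' {b q} := by
  constructor
  · rintro ⟨_, ⟨b, hb, hbA, B, rfl⟩, q, hq, rfl⟩
    exact ⟨b, hb, hbA, B, q, hq, AdaptedBox.connectedComponentIn_fiber hq⟩
  · rintro ⟨b, hb, hbA, B, q, hq, rfl⟩
    exact ⟨_, ⟨b, hb, hbA, B, rfl⟩, q, hq, (AdaptedBox.connectedComponentIn_fiber hq).symm⟩

theorem apply_eq_of_commutingFoliation_rel {a : M → ℂ} (ha : a ∈ A) {x y : M}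
    (h : (commutingFoliation hA hcomm hrich).Rel x y) : a x = a y := by
  refine h.apply_eq fun P hP x hx y hy => ?_
  obtain ⟨b, hb, hbA, B, q, hq, rfl⟩ := (commutingFoliation_isPlaque_iff hA hcomm hrich).1 hP
  exact apply_eq_of_commute hA hcomm hb hbA B ha hx.1 hy.1 (hx.2.trans hy.2.symm)

/-- In an adapted box, a leaf is a single fiber. -/
theorem commutingFoliation_rel_iff (hb : ContMDiff (𝓡 (2 * n)) (𝓡 n) ∞ b)
    (hbA : ∀ i, (fun q => (b q i : ℂ)) ∈ A) (B : AdaptedBox (2 * n) b n) {x q q' : M}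
    (hq : q ∈ B.box.source) (hxq : (commutingFoliation hA hcomm hrich).Rel x q)
    (hq' : q' ∈ B.box.source) :
    (commutingFoliation hA hcomm hrich).Rel x q' ↔ b q' = b q := by
  constructor
  -- The components of `b` lie in `A`, hence are constant along the leaf of `x`.
  · intro h
    ext i
    apply Complex.ofReal_injective
    rw [← apply_eq_of_commutingFoliation_rel hA hcomm hrich (hbA i) h,
      ← apply_eq_of_commutingFoliation_rel hA hcomm hrich (hbA i) hxq]
  -- The fiber through `q` is one plaque, which prolongs the chain from `x` to `q`.
  · intro h
    exact hxq.trans_plaque ((commutingFoliation_isPlaque_iff hA hcomm hrich).2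
      ⟨b, hb, hbA, B, q, hq, rfl⟩) ⟨hq, rfl⟩ ⟨hq', h⟩

theorem commutingFoliation_isLagrangian [T2Space M] [SecondCountableTopology M] :
    (commutingFoliation hA hcomm hrich).IsLagrangian Ω := by
  rintro _ ⟨x, rfl⟩
  have hbox (q : M) : ∃ b : M → EuclideanSpace ℝ (Fin n), ContMDiff (𝓡 (2 * n)) (𝓡 n) ∞ b ∧
      (∀ i, (fun q => (b q i : ℂ)) ∈ A) ∧
      ∃ B : AdaptedBox (2 * n) b n, q ∈ B.box.source := by
    obtain ⟨a, ha, hind⟩ := hrich q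
    exact exists_adaptedBox_of_rich hA ha hind
  choose b hb hbA B hB using hbox
  exact isLagrangianSubmanifold_of_adaptedBox Ω (fun q => hb q) (fun q => B q) (fun q => hB q)
    (fun q q' hq' => commutingFoliation_rel_iff hA hcomm hrich (hb q) (hbA q) (B q) (hB q) q.2 hq')
    fun q v w => form_eq_zero_of_commute hA hcomm (hb q) (hbA q)
      (AdaptedBox.surjective_mvfderiv (hb q) (hB q))

theorem le_leafwiseConstant_commutingFoliation :
    A ≤ (commutingFoliation hA hcomm hrich).leafwiseConstant := by
  intro a ha
  refine ⟨hA ha, ?_⟩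
  rintro _ ⟨x, rfl⟩ y hy z hz
  rw [← apply_eq_of_commutingFoliation_rel hA hcomm hrich ha hy,
    ← apply_eq_of_commutingFoliation_rel hA hcomm hrich ha hz]

end CommutingFunctions

end LagFol

theorem theorem1p1 {n : ℕ} {M : Type*} [TopologicalSpace M] [T2Space M]
    [SecondCountableTopology M] [ChartedSpace (EuclideanSpace ℝ (Fin (2 * n))) M]
    [IsManifold (𝓡 (2 * n)) ∞ M] (Ω : LagFol.SymplecticForm (2 * n) M)
    (A : Submodule ℂ (M → ℂ)) (hA : A ≤ LagFol.smoothFunctions (2 * n) M)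
    (hconj : ∀ a ∈ A, (fun p => (starRingEnd ℂ) (a p)) ∈ A)
    (hcomm : ∀ a ∈ A, ∀ b ∈ A, ∀ p : M, Ω.poissonBracket a b p = 0)
    (hrich : ∀ p : M, ∃ a : Fin n → M → ℝ, (∀ i, (fun q => (a i q : ℂ)) ∈ A) ∧
      LinearIndependent ℝ (fun i => mvfderiv (𝓡 (2 * n)) (a i) p)) :
    ∃ F : LagFol.Foliation (2 * n) M n, F.IsLagrangian Ω ∧ A ≤ F.leafwiseConstant := by
  exact ⟨LagFol.commutingFoliation hA hcomm hrich,
    LagFol.commutingFoliation_isLagrangian hA hcomm hrich,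
    LagFol.le_leafwiseConstant_commutingFoliation hA hcomm hrich⟩
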